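/- Let $1\le k\le n$ and let $A:[0,\infty)\to\mathbb R^{n\times n}$ be continuous. Suppose that there are a symmetric matrix $Q\succ 0$ and a continuous function $\theta:[0,\infty)\to\mathbb R$ such that \[ A(t)^TQ+QA(t)+2\theta(t)Q\succeq 0\quad\text{for all } t\ge 0, \] and let $P\succ 0$ be the symmetric matrix with $P^2=Q$. Suppose also that for some $\eta>0$ \[ \operatorname{tr}A(t)+(n-k)\,\theta(t)\le-\eta<0\quad\text{for all } t\ge 0 . \] Then the LTV system $\dot x=A(t)x$ is $k$-contracting with rate $\eta$ with respect to the scaled $L_2$ norm with weight $P$. Explicitly, for a matrix $M$ let $M^{(k)}$ denote its $k$-multiplicative compound (the matrix of all $k\times k$ minors of $M$, with rows and columns indexed by increasing sequences of length $k$), for square $M$ let $M^{[k]}=\frac{d}{d\varepsilon}(I+\varepsilon M)^{(k)}\big|_{\varepsilon=0}$ be its $k$-additive compound, and let $|y|_{2,P^{(k)}}=|P^{(k)}y|_2$ for $y\in\mathbb R^{\binom nk}$. Then: (i) for all $t\ge t_0\ge 0$ and all solutions $x^1,\dots,x^k$ of $\dot x=A(t)x$ on $[t_0,\infty)$, \[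 \bigl|[x^1(t)\ \cdots\ x^k(t)]^{(k)}\bigr|_{2,P^{(k)}}\le e^{-\eta(t-t_0)}\,\bigl|[x^1(t_0)\ \cdots\ x^k(t_0)]^{(k)}\bigr|_{2,P^{(k)}}, \] that is, the $P$-scaled volume of the parallelotope spanned by any $k$ solutions decays at rate $\eta$; (ii) the infinitesimal condition for $k$-contraction holds: $\mu_{2,P^{(k)}}\bigl(A(t)^{[k]}\bigr)\le-\eta$ for all $t\ge0$, where $\mu_{2,P^{(k)}}(M)=\lim_{\varepsilon\downarrow0}(\|I+\varepsilon M\|-1)/\varepsilon$ is the log norm induced by $|\cdot|_{2,P^{(k)}}$ (the limit exists). -/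

import Mathlib

open Set Filter Topology

noncomputable section

namespace KContraction

/-- `Q(k,n)`: the strictly increasing sequences of `k` elements of `Fin n`. -/
abbrev IncSeq (k n : ℕ) : Type := Fin k ↪o Fin n

instance instFintypeIncSeq (k n : ℕ) : Fintype (IncSeq k n) :=
  Fintype.ofInjective (fun α : IncSeq k n => (α : Fin k → Fin n)) DFunLike.coe_injective

instance instDecidableEqIncSeq (k n : ℕ) : DecidableEq (IncSeq k n) :=
  Classical.decEq _

/-- The `k`-multiplicative compound `M^{(k)}`: the matrix of all `k`-minors `M(α|β)`. -/
def mulCompound {n m : ℕ} (k : ℕ) (M : Matrix (Fin n) (Fin m) ℝ) :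
    Matrix (IncSeq k n) (IncSeq k m) ℝ :=
  Matrix.of fun α β => (M.submatrix α β).det

/-- The `k`-additive compound `A^{[k]} = d/dε (I + ε A)^{(k)} |_{ε = 0}`, taken entry by entry
(every entry is a polynomial in `ε`). -/
def addCompound {n : ℕ} (k : ℕ) (A : Matrix (Fin n) (Fin n) ℝ) :
    Matrix (IncSeq k n) (IncSeq k n) ℝ :=
  Matrix.of fun α β => deriv (fun ε : ℝ => mulCompound k (1 + ε • A) α β) 0

/-- The scaled Euclidean norm `|y|_{2,H} = |H y|_2`. -/
def scaledL2 {ι : Type*} [Fintype ι] (H : Matrix ι ι ℝ) (y : ι → ℝ) : ℝ :=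
  ‖WithLp.toLp 2 (H.mulVec y)‖

/-- The matrix norm induced by a vector norm `N`: the supremum of `N (M y)` over `N y = 1`. -/
def inducedNorm {ι : Type*} [Fintype ι] (N : (ι → ℝ) → ℝ) (M : Matrix ι ι ℝ) : ℝ :=
  sSup {r : ℝ | ∃ y : ι → ℝ, N y = 1 ∧ r = N (M.mulVec y)}

/-- `m` is the log norm of `M` induced by `N`: the limit of `(‖I + ε M‖ - 1) / ε` as `ε ↓ 0`
exists and is equal to `m`. -/
def HasLogNorm {ι : Type*} [Fintype ι] [DecidableEq ι] (N : (ι → ℝ) → ℝ) (M : Matrix ι ι ℝ)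
    (m : ℝ) : Prop :=
  Tendsto (fun ε : ℝ => (inducedNorm N (1 + ε • M) - 1) / ε) (𝓝[>] 0) (𝓝 m)

/-- `x` solves `ẋ = A(t) x` on `[t₀, ∞)`. -/
def IsSolution {n : ℕ} (A : ℝ → Matrix (Fin n) (Fin n) ℝ) (t₀ : ℝ) (x : ℝ → Fin n → ℝ) : Prop :=
  ∀ t, t₀ ≤ t → HasDerivWithinAt x ((A t).mulVec (x t)) (Ici t₀) t

/-- The vector `[x¹ ⋯ xᵏ]^{(k)}` in `ℝ^{Q(k,n)}` attached to the parallelotope spanned by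
`x¹, …, xᵏ`: its entries are the maximal minors of the `n × k` matrix with columns `xⁱ`. -/
def parallelotopeVec {n k : ℕ} (x : Fin k → Fin n → ℝ) : IncSeq k n → ℝ :=
  fun α => mulCompound k (Matrix.of fun (a : Fin n) (i : Fin k) => x i a) α (RelEmbedding.refl _)

/-- The LTV system `ẋ = A(t) x`, `t ≥ 0`, is `k`-contracting with rate `η > 0` with respect to a
norm `N` on `ℝ^{Q(k,n)}`: along any `k` solutions starting at a time `t₀ ≥ 0`, the size of the
parallelotope that they span decays at least as fast as `exp (-η (t - t₀))`. -/
def IsKContracting {n : ℕ} (k : ℕ) (A : ℝ → Matrix (Fin n) (Fin n) ℝ)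
    (N : (IncSeq k n → ℝ) → ℝ) (η : ℝ) : Prop :=
  0 < η ∧ ∀ t₀ : ℝ, 0 ≤ t₀ → ∀ x : Fin k → ℝ → Fin n → ℝ, (∀ i, IsSolution A t₀ (x i)) →
    ∀ t : ℝ, t₀ ≤ t →
      N (parallelotopeVec fun i => x i t) ≤
        Real.exp (-η * (t - t₀)) * N (parallelotopeVec fun i => x i t₀)

end KContraction

end

namespace KContraction

open Matrix

/-! In the coordinates `P x` the system matrix is `B = P A P⁻¹`, and the Lyapunov inequality says
that `T = Bᵀ + B + 2θ I` is positive semidefinite. The eigenvalues of `T^{[k]}` are sums of `k`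
eigenvalues of `T`, hence at most `tr T`. Since the additive compound is linear and sends `I` to `k
I`, half of this bound reads `⟨v, B^{[k]} v⟩ ≤ (tr A + (n - k)θ)|v|² ≤ -η|v|²`
(`dotProduct_addCompound_mulVec_le`).

Both claims follow from this bound on the numerical range. Cauchy-Binet makes `P^{(k)}` intertwine
`A^{[k]}` and `B^{[k]}`, so the scaled parallelotope vector obeys an energy estimate
(`norm_le_exp_mul_of_hasDerivWithinAt`), and the log norm is the supremum of the numerical range
(`exists_hasLogNorm_le`). -/

/-! ### Cauchy-Binet and multiplicative compounds. -/

theorem det_mul_eq_sum_prod_mul_det {m k : ℕ} (A : Matrix (Fin k) (Fin m) ℝ)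
    (B : Matrix (Fin m) (Fin k) ℝ) :
    (A * B).det = ∑ p : Fin k → Fin m, (∏ i, A i (p i)) * (B.submatrix p id).det := by
  have h : A * B = fun i => ∑ j, A i j • B j := by
    ext i l
    simp [Matrix.mul_apply, Finset.sum_apply]
  change detRowAlternating.toMultilinearMap (A * B) = _
  rw [h, MultilinearMap.map_sum]
  refine Finset.sum_congr rfl fun p _ => ?_
  rw [MultilinearMap.map_smul_univ]
  rfl

/-- The Cauchy-Binet formula. -/
theorem det_mul_eq_sum_det_mul_det {m k : ℕ} (A : Matrix (Fin k) (Fin m) ℝ)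
    (B : Matrix (Fin m) (Fin k) ℝ) :
    (A * B).det = ∑ γ : IncSeq k m, (A.submatrix id γ).det * (B.submatrix γ id).det := by
  have hR : ∀ γ : IncSeq k m, (A.submatrix id γ).det * (B.submatrix γ id).det =
      ∑ σ : Equiv.Perm (Fin k), (∏ i, A i (γ (σ i))) * (B.submatrix (γ ∘ σ) id).det := by
    intro γ
    rw [← det_transpose, det_apply', Finset.sum_mul]
    refine Finset.sum_congr rfl fun σ _ => ?_
    have h : (B.submatrix (γ ∘ σ) id).det =
        (Equiv.Perm.sign σ : ℤ) * (B.submatrix γ id).det := by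
      rw [← det_permute]; rfl
    rw [h]
    simp only [transpose_apply, submatrix_apply, id]
    ring
  rw [det_mul_eq_sum_prod_mul_det, Finset.sum_congr rfl fun γ _ => hR γ, ← Fintype.sum_prod_type']
  symm
  -- An injective tuple is uniquely an increasing sequence composed with a permutation; any other
  -- tuple repeats a row of `B` and contributes zero.
  refine Finset.sum_of_injOn (fun x : IncSeq k m × Equiv.Perm (Fin k) => x.1 ∘ x.2) ?_ ?_ ?_ ?_
  · rintro ⟨γ, σ⟩ - ⟨δ, τ⟩ - h
    have hr : γ = δ := by
      apply OrderEmbedding.range_inj.1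
      have := congrArg Set.range h
      simpa [Set.range_comp] using this
    subst hr
    refine Prod.ext rfl (Equiv.ext fun i => γ.injective (congrFun h i))
  · simp
  · intro p _ hp
    by_cases hinj : Function.Injective p
    · exfalso
      apply hp
      have hmono : StrictMono (p ∘ Tuple.sort p) :=
        (Tuple.monotone_sort p).strictMono_of_injective (hinj.comp (Equiv.injective _))
      refine ⟨(OrderEmbedding.ofStrictMono _ hmono, (Tuple.sort p)⁻¹), by simp, ?_⟩
      ext i
      simp
    · obtain ⟨i, j, hij, hne⟩ : ∃ i j, p i = p j ∧ i ≠ j := by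
        simpa [Function.Injective] using hinj
      rw [det_zero_of_row_eq hne, mul_zero]
      ext l
      simp [hij]
  · intros
    rfl

theorem mulCompound_mul {n m l : ℕ} (k : ℕ) (M : Matrix (Fin n) (Fin m) ℝ)
    (N : Matrix (Fin m) (Fin l) ℝ) :
    mulCompound k (M * N) = mulCompound k M * mulCompound k N := by
  ext α β
  simp only [mulCompound, of_apply, mul_apply]
  rw [submatrix_mul M N α id β Function.bijective_id, det_mul_eq_sum_det_mul_det]
  rfl

theorem mulCompound_transpose {n m : ℕ} (k : ℕ) (M : Matrix (Fin n) (Fin m) ℝ) :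
    mulCompound k Mᵀ = (mulCompound k M)ᵀ := by
  ext α β
  simp only [mulCompound, of_apply, transpose_apply]
  rw [← transpose_submatrix, det_transpose]

theorem mulCompound_diagonal {n : ℕ} (k : ℕ) (d : Fin n → ℝ) :
    mulCompound k (diagonal d) = diagonal fun α : IncSeq k n => ∏ i, d (α i) := by
  ext α β
  simp only [mulCompound, of_apply]
  by_cases h : α = β
  · subst h
    rw [diagonal_apply_eq, submatrix_diagonal _ _ α.injective, det_diagonal]
    rfl
  · rw [diagonal_apply_ne _ h]
    -- Increasing sequences are determined by their ranges, so some `β j` is missed by `α`, and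
    -- column `j` of the minor vanishes.
    obtain ⟨j, hj⟩ : ∃ j, ∀ i, α i ≠ β j := by
      by_contra! hc
      apply h
      choose f hf using hc
      have hinj : Function.Injective f := fun a b hab => β.injective (by rw [← hf, ← hf, hab])
      have hsurj := Finite.surjective_of_injective hinj
      apply OrderEmbedding.range_inj.1
      ext x
      constructor
      · rintro ⟨i, rfl⟩
        obtain ⟨j, rfl⟩ := hsurj i
        exact ⟨j, (hf j).symm⟩
      · rintro ⟨j, rfl⟩
        exact ⟨f j, hf j⟩
    exact det_eq_zero_of_column_eq_zero j fun i => diagonal_apply_ne _ (hj i)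

theorem mulCompound_one {n : ℕ} (k : ℕ) : mulCompound k (1 : Matrix (Fin n) (Fin n) ℝ) = 1 := by
  rw [← diagonal_one, mulCompound_diagonal]
  simp

/-! ### Additive compounds. -/

theorem hasDerivAt_one_add_smul_mulCompound {n : ℕ} (k : ℕ) (A : Matrix (Fin n) (Fin n) ℝ)
    (α β : IncSeq k n) :
    HasDerivAt (fun ε : ℝ => mulCompound k (1 + ε • A) α β) (addCompound k A α β) 0 := by
  apply DifferentiableAt.hasDerivAt
  simp only [mulCompound, of_apply, det_apply, submatrix_apply, Matrix.add_apply,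
    Matrix.smul_apply]
  fun_prop

/-- `M ↦ M^{(k)}` entry by entry, as a function of the family of entries of `M`. -/
theorem differentiable_mulCompound_apply {n m : ℕ} (k : ℕ) (α : IncSeq k n) (β : IncSeq k m) :
    Differentiable ℝ fun M : Fin n → Fin m → ℝ => mulCompound k (of M) α β := by
  simp only [mulCompound, of_apply, det_apply, submatrix_apply]
  fun_prop

/-- Differentiating `X ↦ X^{(k)}` at `X` in the direction `A X` multiplies it by `A^{[k]}`. -/
theorem fderiv_mulCompound_apply_mul {n m : ℕ} (k : ℕ) (A : Matrix (Fin n) (Fin n) ℝ)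
    (X : Fin n → Fin m → ℝ) (α : IncSeq k n) (β : IncSeq k m) :
    fderiv ℝ (fun M : Fin n → Fin m → ℝ => mulCompound k (of M) α β) X (of.symm (A * of X)) =
      (addCompound k A * mulCompound k (of X)) α β := by
  have hF := (differentiable_mulCompound_apply k α β X).hasFDerivAt
  have hline : HasDerivAt (fun ε : ℝ => X + ε • of.symm (A * of X)) (of.symm (A * of X)) 0 := by
    simpa using ((hasDerivAt_id (0 : ℝ)).smul_const (of.symm (A * of X))).const_add X
  have h1 := HasFDerivAt.comp_hasDerivAt_of_eq (0 : ℝ) hF hline (by simp)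
  have h2 : HasDerivAt (fun ε : ℝ => ∑ γ, mulCompound k (1 + ε • A) α γ *
      mulCompound k (of X) γ β) (∑ γ, addCompound k A α γ * mulCompound k (of X) γ β) 0 :=
    HasDerivAt.fun_sum fun γ _ => (hasDerivAt_one_add_smul_mulCompound k A α γ).mul_const _
  -- Both curves agree because `X + ε A X = (1 + ε A) X` and compounds are multiplicative.
  refine h1.unique (h2.congr_of_eventuallyEq (Eventually.of_forall fun ε => ?_))
  change mulCompound k (of X + ε • (A * of X)) α β = ∑ γ, _
  rw [← mul_apply, ← mulCompound_mul, Matrix.add_mul, Matrix.one_mul, Matrix.smul_mul]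

/-- As the value of a Fréchet derivative at the identity, the additive compound is visibly linear in
`A`. -/
theorem addCompound_eq_fderiv {n : ℕ} (k : ℕ) (A : Matrix (Fin n) (Fin n) ℝ)
    (α β : IncSeq k n) :
    addCompound k A α β =
      fderiv ℝ (fun M : Fin n → Fin n → ℝ => mulCompound k (of M) α β) (of.symm 1)
        (of.symm A) := by
  have h := fderiv_mulCompound_apply_mul k A (of.symm 1) α β
  simpa [mulCompound_one] using h.symm

theorem addCompound_add {n : ℕ} (k : ℕ) (A B : Matrix (Fin n) (Fin n) ℝ) :
    addCompound k (A + B) = addCompound k A + addCompound k B := by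
  ext α β
  simp only [addCompound_eq_fderiv, Matrix.add_apply]
  exact map_add _ _ _

theorem addCompound_smul {n : ℕ} (k : ℕ) (c : ℝ) (A : Matrix (Fin n) (Fin n) ℝ) :
    addCompound k (c • A) = c • addCompound k A := by
  ext α β
  simp only [addCompound_eq_fderiv, Matrix.smul_apply]
  exact ContinuousLinearMap.map_smul _ c (of.symm A)

theorem addCompound_transpose {n : ℕ} (k : ℕ) (A : Matrix (Fin n) (Fin n) ℝ) :
    addCompound k Aᵀ = (addCompound k A)ᵀ := by
  ext α β
  simp only [addCompound, of_apply, transpose_apply]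
  congr 1
  ext ε
  have h : 1 + ε • Aᵀ = (1 + ε • A)ᵀ := by simp
  rw [h, mulCompound_transpose, transpose_apply]

theorem addCompound_diagonal {n : ℕ} (k : ℕ) (d : Fin n → ℝ) :
    addCompound k (diagonal d) = diagonal fun α : IncSeq k n => ∑ i, d (α i) := by
  ext α β
  have h : (fun ε : ℝ => mulCompound k (1 + ε • diagonal d) α β) =
      fun ε => if α = β then ∏ i, (1 + ε * d (α i)) else 0 := by
    ext ε
    rw [← diagonal_one, ← diagonal_smul, diagonal_add, mulCompound_diagonal, diagonal_apply]
    simp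
  simp only [addCompound, of_apply, h, diagonal_apply]
  split_ifs
  · have := HasDerivAt.fun_finsetProd (u := Finset.univ) (x := (0 : ℝ))
      (f := fun (i : Fin k) (ε : ℝ) => 1 + ε * d (α i)) (f' := fun i => d (α i))
      fun i _ => by simpa using ((hasDerivAt_id (0 : ℝ)).mul_const (d (α i))).const_add 1
    simpa using this.deriv
  · simp

theorem addCompound_one {n : ℕ} (k : ℕ) :
    addCompound k (1 : Matrix (Fin n) (Fin n) ℝ) = (k : ℝ) • 1 := by
  rw [← diagonal_one, addCompound_diagonal, ← diagonal_one, ← diagonal_smul]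
  congr 1
  ext
  simp

/-- If `P` intertwines `A` and `B`, then `P^{(k)}` intertwines `A^{[k]}` and `B^{[k]}`. -/
theorem mulCompound_mul_addCompound {n : ℕ} (k : ℕ) {P A B : Matrix (Fin n) (Fin n) ℝ}
    (h : P * A = B * P) :
    mulCompound k P * addCompound k A = addCompound k B * mulCompound k P := by
  ext α β
  simp only [mul_apply]
  have h1 : HasDerivAt (fun ε : ℝ => ∑ γ, mulCompound k P α γ * mulCompound k (1 + ε • A) γ β)
      (∑ γ, mulCompound k P α γ * addCompound k A γ β) 0 :=
    HasDerivAt.fun_sum fun γ _ => (hasDerivAt_one_add_smul_mulCompound k A γ β).const_mul _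
  have h2 : HasDerivAt (fun ε : ℝ => ∑ γ, mulCompound k (1 + ε • B) α γ * mulCompound k P γ β)
      (∑ γ, addCompound k B α γ * mulCompound k P γ β) 0 :=
    HasDerivAt.fun_sum fun γ _ => (hasDerivAt_one_add_smul_mulCompound k B α γ).mul_const _
  refine h1.unique (h2.congr_of_eventuallyEq (Eventually.of_forall fun ε => ?_))
  change ∑ γ, _ = ∑ γ, _
  rw [← mul_apply, ← mul_apply, ← mulCompound_mul, ← mulCompound_mul, Matrix.mul_add,
    Matrix.add_mul, Matrix.mul_smul, Matrix.smul_mul, h, Matrix.mul_one, Matrix.one_mul]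

/-! ### The numerical range of the additive compound. -/

theorem dotProduct_mulVec_transpose_self {ι : Type*} [Fintype ι] (M : Matrix ι ι ℝ) (v : ι → ℝ) :
    v ⬝ᵥ (Mᵀ *ᵥ v) = v ⬝ᵥ (M *ᵥ v) := by
  rw [mulVec_transpose, dotProduct_comm, dotProduct_mulVec]

/-- For positive semidefinite `T`, `T^{[k]} ≤ tr T` as quadratic forms. -/
theorem dotProduct_addCompound_mulVec_le_trace {n : ℕ} (k : ℕ) {T : Matrix (Fin n) (Fin n) ℝ}
    (hT : T.PosSemidef) (v : IncSeq k n → ℝ) :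
    v ⬝ᵥ (addCompound k T *ᵥ v) ≤ T.trace * (v ⬝ᵥ v) := by
  set d := hT.isHermitian.eigenvalues
  set U : Matrix (Fin n) (Fin n) ℝ := hT.isHermitian.eigenvectorUnitary.1
  have hUU : Uᵀ * U = 1 := Unitary.coe_star_mul_self hT.isHermitian.eigenvectorUnitary
  have hUU' : U * Uᵀ = 1 := Unitary.coe_mul_star_self hT.isHermitian.eigenvectorUnitary
  have hspec : T = U * diagonal d * Uᵀ := by
    have h := hT.isHermitian.spectral_theorem
    rwa [Unitary.conjStarAlgAut_apply] at h
  have htrace : T.trace = ∑ i, d i := by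
    rw [hspec, trace_mul_comm, ← Matrix.mul_assoc, hUU, Matrix.one_mul, trace_diagonal]
  have hinter : Uᵀ * T = diagonal d * Uᵀ := by
    rw [hspec, Matrix.mul_assoc, ← Matrix.mul_assoc Uᵀ, hUU, Matrix.one_mul]
  set V := mulCompound k U
  have hVV : V * Vᵀ = 1 := by
    rw [← mulCompound_transpose, ← mulCompound_mul, hUU', mulCompound_one]
  have hcomp := mulCompound_mul_addCompound k hinter
  rw [mulCompound_transpose] at hcomp
  have hadd : addCompound k T = V * (addCompound k (diagonal d) * Vᵀ) := by
    rw [← hcomp, ← Matrix.mul_assoc, hVV, Matrix.one_mul]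
  set w := Vᵀ *ᵥ v
  have hw : w ⬝ᵥ w = v ⬝ᵥ v := by
    rw [show w ⬝ᵥ w = w ⬝ᵥ (Vᵀ *ᵥ v) from rfl, mulVec_transpose, dotProduct_comm,
      ← dotProduct_mulVec, mulVec_mulVec, hVV, one_mulVec]
  have hq : v ⬝ᵥ (addCompound k T *ᵥ v) = ∑ α : IncSeq k n, (∑ i, d (α i)) * (w α * w α) := by
    rw [hadd, ← mulVec_mulVec, ← mulVec_mulVec, dotProduct_mulVec, ← mulVec_transpose,
      addCompound_diagonal]
    simp only [dotProduct, mulVec_diagonal]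
    exact Finset.sum_congr rfl fun α _ => by ring
  rw [hq, ← hw, htrace, dotProduct, Finset.mul_sum]
  refine Finset.sum_le_sum fun α _ => mul_le_mul_of_nonneg_right ?_ (mul_self_nonneg _)
  -- A sum over `k` distinct eigenvalue indices is at most the full sum, the eigenvalues being
  -- nonnegative.
  calc ∑ i, d (α i) = ∑ j ∈ Finset.univ.map α.toEmbedding, d j :=
        (Finset.sum_map Finset.univ α.toEmbedding d).symm
    _ ≤ ∑ j, d j := Finset.sum_le_univ_sum_of_nonneg hT.eigenvalues_nonneg

theorem dotProduct_addCompound_mulVec_le {n : ℕ} (k : ℕ) {B : Matrix (Fin n) (Fin n) ℝ} {θ : ℝ}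
    (hB : (Bᵀ + B + (2 * θ) • (1 : Matrix (Fin n) (Fin n) ℝ)).PosSemidef)
    (v : IncSeq k n → ℝ) :
    v ⬝ᵥ (addCompound k B *ᵥ v) ≤ (B.trace + ((n : ℝ) - k) * θ) * (v ⬝ᵥ v) := by
  have h := dotProduct_addCompound_mulVec_le_trace k hB v
  simp only [addCompound_add, addCompound_smul, addCompound_one, addCompound_transpose,
    add_mulVec, dotProduct_add, dotProduct_mulVec_transpose_self, smul_mulVec, one_mulVec,
    dotProduct_smul, smul_eq_mul, trace_add, trace_smul, trace_transpose, trace_one,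
    Fintype.card_fin] at h
  linarith

/-! ### The log norm of a scaled Euclidean norm. -/

theorem scaledL2_eq_sqrt {ι : Type*} [Fintype ι] (H : Matrix ι ι ℝ) (y : ι → ℝ) :
    scaledL2 H y = √((H *ᵥ y) ⬝ᵥ (H *ᵥ y)) := by
  rw [scaledL2, EuclideanSpace.norm_eq]
  simp [dotProduct, sq]

theorem norm_toLp_sq {ι : Type*} [Fintype ι] (y : ι → ℝ) :
    ‖WithLp.toLp 2 y‖ ^ 2 = y ⬝ᵥ y := by
  rw [EuclideanSpace.norm_sq_eq]
  simp [dotProduct, sq]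

/-- If `C = H M H⁻¹`, then the log norm of `M` induced by the scaled Euclidean norm with weight `H`
exists and is bounded by every upper bound of the numerical range of `C`: in fact
`1 + ε C` has the operator norm `1 + ε λ + O(ε²)`, where `λ` is the supremum of that range. -/
theorem exists_hasLogNorm_le {ι : Type*} [Fintype ι] [DecidableEq ι] [Nonempty ι]
    {H M C : Matrix ι ι ℝ} (hH : IsUnit H) (hC : H * M = C * H) {c : ℝ}
    (hc : ∀ v : ι → ℝ, v ⬝ᵥ (C *ᵥ v) ≤ c * (v ⬝ᵥ v)) :
    ∃ m, HasLogNorm (scaledL2 H) M m ∧ m ≤ c := by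
  set L := toEuclideanCLM (𝕜 := ℝ) C
  have hL : ∀ v : ι → ℝ, WithLp.toLp 2 (C *ᵥ v) = L (WithLp.toLp 2 v) := fun v => rfl
  set S : Set ℝ := {r | ∃ z : EuclideanSpace ℝ ι, ‖z‖ = 1 ∧ r = inner ℝ z (L z)}
  set R : ℝ → Set ℝ := fun ε => {r | ∃ z : EuclideanSpace ℝ ι, ‖z‖ = 1 ∧ r = ‖z + ε • L z‖}
  -- The substitution `z = H y` carries the scaled unit sphere onto the Euclidean one.
  have hR : ∀ ε, inducedNorm (scaledL2 H) (1 + ε • M) = sSup (R ε) := by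
    intro ε
    have key : ∀ y : ι → ℝ, scaledL2 H ((1 + ε • M) *ᵥ y) =
        ‖WithLp.toLp 2 (H *ᵥ y) + ε • L (WithLp.toLp 2 (H *ᵥ y))‖ := by
      intro y
      rw [scaledL2, ← hL, mulVec_mulVec, mulVec_mulVec, Matrix.mul_add, Matrix.mul_smul, hC,
        Matrix.mul_one, add_mulVec, smul_mulVec]
      rfl
    rw [inducedNorm]
    congr 1
    ext r
    constructor
    · rintro ⟨y, hy, rfl⟩
      exact ⟨WithLp.toLp 2 (H *ᵥ y), hy, key y⟩
    · rintro ⟨z, hz, rfl⟩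
      have hinv : H *ᵥ (H⁻¹ *ᵥ z.ofLp) = z.ofLp := by
        rw [mulVec_mulVec, mul_nonsing_inv _ ((isUnit_iff_isUnit_det H).1 hH), one_mulVec]
      refine ⟨H⁻¹ *ᵥ z.ofLp, ?_, ?_⟩
      · rw [scaledL2, hinv]; exact hz
      · rw [key, hinv]
  obtain ⟨z₀, hz₀⟩ : ∃ z : EuclideanSpace ℝ ι, ‖z‖ = 1 := by
    classical
    exact ⟨EuclideanSpace.single (Classical.arbitrary ι) 1, by simp⟩
  have hSc : ∀ r ∈ S, r ≤ c := by
    rintro r ⟨z, hz, rfl⟩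
    have h := hc z.ofLp
    rw [← norm_toLp_sq, show ‖WithLp.toLp 2 z.ofLp‖ = 1 from hz] at h
    rw [EuclideanSpace.inner_eq_star_dotProduct, dotProduct_comm]
    simpa [show (L z).ofLp = C *ᵥ z.ofLp from rfl] using h
  have hSbdd : BddAbove S := ⟨c, hSc⟩
  have hSne : S.Nonempty := ⟨_, z₀, hz₀, rfl⟩
  refine ⟨sSup S, ?_, csSup_le hSne hSc⟩
  -- Expand `r²` and use `r ≤ (1 + r²) / 2`, which avoids square roots.
  have hupper : ∀ ε : ℝ, 0 < ε → ∀ r ∈ R ε, r ≤ 1 + ε * sSup S + ε ^ 2 * (‖L‖ ^ 2 / 2) := by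
    rintro ε hε r ⟨z, hz, rfl⟩
    have h1 : inner ℝ z (L z) ≤ sSup S := le_csSup hSbdd ⟨z, hz, rfl⟩
    have h2 : ‖L z‖ ≤ ‖L‖ := by simpa [hz] using L.le_opNorm z
    have h3 : ‖L z‖ ^ 2 ≤ ‖L‖ ^ 2 := by gcongr
    have h4 : ‖z + ε • L z‖ ^ 2 = 1 + 2 * (ε * inner ℝ z (L z)) + ε ^ 2 * ‖L z‖ ^ 2 := by
      rw [norm_add_sq_real, hz, real_inner_smul_right, norm_smul, mul_pow, Real.norm_eq_abs,
        sq_abs]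
      ring
    have h5 : ε * inner ℝ z (L z) ≤ ε * sSup S := by gcongr
    have h6 : ε ^ 2 * ‖L z‖ ^ 2 ≤ ε ^ 2 * ‖L‖ ^ 2 := by gcongr
    linarith [sq_nonneg (‖z + ε • L z‖ - 1)]
  -- By Cauchy-Schwarz, `1 + ε ⟨z, L z⟩ = ⟨z, z + ε L z⟩ ≤ ‖z + ε L z‖`.
  have hlower : ∀ ε : ℝ, 0 < ε → sSup S ≤ (sSup (R ε) - 1) / ε := by
    intro ε hε
    refine csSup_le hSne ?_
    rintro r ⟨z, hz, rfl⟩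
    rw [le_div_iff₀ hε]
    have h1 : ‖z + ε • L z‖ ≤ sSup (R ε) := le_csSup ⟨_, hupper ε hε⟩ ⟨z, hz, rfl⟩
    have h2 := real_inner_le_norm z (z + ε • L z)
    rw [inner_add_right, real_inner_smul_right, real_inner_self_eq_norm_sq, hz] at h2
    linarith
  have hlim : Tendsto (fun ε : ℝ => sSup S + ε * (‖L‖ ^ 2 / 2)) (𝓝[>] 0) (𝓝 (sSup S)) := by
    have h : Continuous fun ε : ℝ => sSup S + ε * (‖L‖ ^ 2 / 2) := by fun_prop
    simpa using (h.tendsto 0).mono_left nhdsWithin_le_nhds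
  refine tendsto_of_tendsto_of_tendsto_of_le_of_le' tendsto_const_nhds hlim ?_ ?_
  · filter_upwards [self_mem_nhdsWithin] with ε hε
    rw [hR]
    exact hlower ε hε
  · filter_upwards [self_mem_nhdsWithin] with ε hε
    rw [hR, div_le_iff₀ hε]
    have h := csSup_le (s := R ε) ⟨_, z₀, hz₀, rfl⟩ (hupper ε hε)
    linarith

/-! ### Decay along solutions. -/

/-- The parallelotope vector of `k` solutions of `ẋ = A(t) x` solves the `k`-th compound
equation `ẏ = A(t)^{[k]} y`. -/
theorem hasDerivWithinAt_parallelotopeVec {n k : ℕ} {A : ℝ → Matrix (Fin n) (Fin n) ℝ} {t₀ : ℝ}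
    {x : Fin k → ℝ → Fin n → ℝ} (hx : ∀ i, IsSolution A t₀ (x i)) {t : ℝ} (ht : t₀ ≤ t) :
    HasDerivWithinAt (fun s => parallelotopeVec fun i => x i s)
      (addCompound k (A t) *ᵥ parallelotopeVec fun i => x i t) (Ici t₀) t := by
  rw [hasDerivWithinAt_pi]
  intro α
  set X : ℝ → Fin n → Fin k → ℝ := fun s a i => x i s a
  have hX : HasDerivWithinAt X (of.symm (A t * of (X t))) (Ici t₀) t := by
    refine hasDerivWithinAt_pi.2 fun a => hasDerivWithinAt_pi.2 fun i => ?_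
    exact hasDerivWithinAt_pi.1 (hx i t ht) a
  have hF := (differentiable_mulCompound_apply k α (RelEmbedding.refl _) (X t)).hasFDerivAt
  have h := hF.comp_hasDerivWithinAt t hX
  rw [fderiv_mulCompound_apply_mul] at h
  exact h

/-- The energy `exp (2η(s - t₀)) |z s|²` has nonpositive derivative. -/
theorem norm_le_exp_mul_of_hasDerivWithinAt {ι : Type*} [Fintype ι] {C : ℝ → Matrix ι ι ℝ}
    {z : ℝ → ι → ℝ} {t₀ η : ℝ}
    (hz : ∀ t, t₀ ≤ t → HasDerivWithinAt z (C t *ᵥ z t) (Ici t₀) t)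
    (hC : ∀ t, t₀ ≤ t → ∀ v, v ⬝ᵥ (C t *ᵥ v) ≤ -η * (v ⬝ᵥ v)) {t : ℝ} (ht : t₀ ≤ t) :
    √(z t ⬝ᵥ z t) ≤ Real.exp (-η * (t - t₀)) * √(z t₀ ⬝ᵥ z t₀) := by
  set f : ℝ → ℝ := fun s => Real.exp (2 * η * (s - t₀)) * (z s ⬝ᵥ z s)
  have hf : ∀ s, t₀ ≤ s → HasDerivWithinAt f (Real.exp (2 * η * (s - t₀)) *
      (2 * (η * (z s ⬝ᵥ z s) + z s ⬝ᵥ (C s *ᵥ z s)))) (Ici t₀) s := by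
    intro s hs
    have h1 : HasDerivWithinAt (fun s => z s ⬝ᵥ z s) (2 * (z s ⬝ᵥ (C s *ᵥ z s))) (Ici t₀) s := by
      have h : HasDerivWithinAt (fun s => ∑ i, z s i * z s i)
          (∑ i, ((C s *ᵥ z s) i * z s i + z s i * (C s *ᵥ z s) i)) (Ici t₀) s :=
        HasDerivWithinAt.fun_sum fun i _ =>
          (hasDerivWithinAt_pi.1 (hz s hs) i).mul (hasDerivWithinAt_pi.1 (hz s hs) i)
      refine h.congr_deriv ?_
      rw [dotProduct, Finset.mul_sum]
      exact Finset.sum_congr rfl fun i _ => by ring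
    have h2 : HasDerivWithinAt (fun s => Real.exp (2 * η * (s - t₀)))
        (Real.exp (2 * η * (s - t₀)) * (2 * η)) (Ici t₀) s := by
      simpa using ((((hasDerivAt_id s).sub_const t₀).const_mul (2 * η)).exp).hasDerivWithinAt
    exact (h2.mul h1).congr_deriv (by ring)
  have hanti : AntitoneOn f (Ici t₀) := by
    refine antitoneOn_of_hasDerivWithinAt_nonpos (convex_Ici t₀)
      (fun s hs => (hf s hs).continuousWithinAt)
      (fun s hs => (hf s (interior_subset hs)).mono interior_subset) fun s hs => ?_
    have h := hC s (interior_subset hs) (z s)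
    exact mul_nonpos_of_nonneg_of_nonpos (Real.exp_pos _).le (by linarith)
  have h : f t ≤ f t₀ := hanti self_mem_Ici ht ht
  have hle : z t ⬝ᵥ z t ≤ Real.exp (-η * (t - t₀)) ^ 2 * (z t₀ ⬝ᵥ z t₀) := by
    have h' : f t ≤ z t₀ ⬝ᵥ z t₀ := by simpa [f] using h
    calc z t ⬝ᵥ z t = Real.exp (-η * (t - t₀)) ^ 2 * f t := by
          rw [← Real.exp_nat_mul, ← mul_assoc, ← Real.exp_add]
          have : ((2 : ℕ) : ℝ) * (-η * (t - t₀)) + 2 * η * (t - t₀) = 0 := by push_cast; ring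
          rw [this, Real.exp_zero, one_mul]
      _ ≤ _ := by gcongr
  calc √(z t ⬝ᵥ z t) ≤ √(Real.exp (-η * (t - t₀)) ^ 2 * (z t₀ ⬝ᵥ z t₀)) := Real.sqrt_le_sqrt hle
    _ = _ := by rw [Real.sqrt_mul (sq_nonneg _), Real.sqrt_sq (Real.exp_pos _).le]

/-- Congruence by the symmetric matrix `P⁻¹` preserves semidefiniteness and turns `P ^ 2` into the
identity. -/
theorem posSemidef_conj_of_lyapunov {n : ℕ} {A P : Matrix (Fin n) (Fin n) ℝ} (hP : P.PosDef)
    {θ : ℝ} (h : (Aᵀ * P ^ 2 + P ^ 2 * A + (2 * θ) • P ^ 2).PosSemidef) :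
    ((P * A * P⁻¹)ᵀ + P * A * P⁻¹ + (2 * θ) • (1 : Matrix (Fin n) (Fin n) ℝ)).PosSemidef := by
  have hdet : IsUnit P.det := (isUnit_iff_isUnit_det P).1 hP.isUnit
  have hPt : Pᵀ = P := by simpa [conjTranspose_eq_transpose_of_trivial] using hP.isHermitian.eq
  have h1 : P⁻¹ * P = 1 := nonsing_inv_mul P hdet
  have h2 : P * P⁻¹ = 1 := mul_nonsing_inv P hdet
  have hinv : (P⁻¹)ᴴ = P⁻¹ := hP.isHermitian.inv.eq
  have h' := h.conjTranspose_mul_mul_same P⁻¹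
  rw [hinv] at h'
  convert h' using 1
  have e1 : P⁻¹ * (Aᵀ * P ^ 2) * P⁻¹ = P⁻¹ * Aᵀ * P * (P * P⁻¹) := by noncomm_ring
  have e2 : P⁻¹ * (P ^ 2 * A) * P⁻¹ = (P⁻¹ * P) * P * A * P⁻¹ := by noncomm_ring
  have e3 : P⁻¹ * P ^ 2 * P⁻¹ = (P⁻¹ * P) * (P * P⁻¹) := by noncomm_ring
  rw [Matrix.mul_add, Matrix.mul_add, Matrix.add_mul, Matrix.add_mul, e1, e2, Matrix.mul_smul,
    Matrix.smul_mul, e3, h1, h2, transpose_mul, transpose_mul, transpose_nonsing_inv, hPt]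
  simp only [Matrix.mul_one, Matrix.one_mul, Matrix.mul_assoc]

end KContraction

theorem mainTheorem11 (n k : ℕ) (hk1 : 1 ≤ k) (hkn : k ≤ n)
    (A : ℝ → Matrix (Fin n) (Fin n) ℝ) (hA : ContinuousOn A (Set.Ici 0))
    (Q P : Matrix (Fin n) (Fin n) ℝ) (hQ : Q.PosDef) (hP : P.PosDef) (hPQ : P ^ 2 = Q)
    (θ : ℝ → ℝ) (hθ : ContinuousOn θ (Set.Ici 0))
    (hLyap : ∀ t : ℝ, 0 ≤ t →
      ((A t).transpose * Q + Q * A t + (2 * θ t) • Q).PosSemidef)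
    (η : ℝ) (hη : 0 < η)
    (htr : ∀ t : ℝ, 0 ≤ t → (A t).trace + ((n : ℝ) - (k : ℝ)) * θ t ≤ -η) :
    KContraction.IsKContracting k A
        (KContraction.scaledL2 (KContraction.mulCompound k P)) η ∧
      ∀ t : ℝ, 0 ≤ t → ∃ m : ℝ,
        KContraction.HasLogNorm (KContraction.scaledL2 (KContraction.mulCompound k P))
          (KContraction.addCompound k (A t)) m ∧ m ≤ -η := by
  open KContraction Matrix in
  have hdet : IsUnit P.det := (isUnit_iff_isUnit_det P).1 hP.isUnit
  have hinv : P⁻¹ * P = 1 := nonsing_inv_mul P hdet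
  set B : ℝ → Matrix (Fin n) (Fin n) ℝ := fun t => P * A t * P⁻¹
  have hPA : ∀ t, mulCompound k P * addCompound k (A t) =
      addCompound k (B t) * mulCompound k P := fun t =>
    mulCompound_mul_addCompound k (by simp only [B]; rw [Matrix.mul_assoc, hinv, Matrix.mul_one])
  have hquad : ∀ t, 0 ≤ t → ∀ v : IncSeq k n → ℝ,
      v ⬝ᵥ (addCompound k (B t) *ᵥ v) ≤ -η * (v ⬝ᵥ v) := by
    intro t ht v
    have hL := hLyap t ht
    rw [← hPQ] at hL
    have htrB : (B t).trace = (A t).trace := by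
      simp only [B]
      rw [trace_mul_comm, ← Matrix.mul_assoc, hinv, Matrix.one_mul]
    refine (dotProduct_addCompound_mulVec_le k (posSemidef_conj_of_lyapunov hP hL) v).trans ?_
    have h0 : 0 ≤ v ⬝ᵥ v := norm_toLp_sq v ▸ sq_nonneg _
    exact mul_le_mul_of_nonneg_right (htrB ▸ htr t ht) h0
  refine ⟨⟨hη, fun t₀ ht₀ x hx t ht => ?_⟩, fun t ht => ?_⟩
  · rw [scaledL2_eq_sqrt, scaledL2_eq_sqrt]
    refine norm_le_exp_mul_of_hasDerivWithinAt
      (z := fun s => mulCompound k P *ᵥ parallelotopeVec fun i => x i s)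
      (C := fun s => addCompound k (B s)) (fun s hs => ?_) (fun s hs => hquad s (ht₀.trans hs)) ht
    have h := (mulVecLin (mulCompound k P)).toContinuousLinearMap.hasFDerivAt.comp_hasDerivWithinAt
      s (hasDerivWithinAt_parallelotopeVec hx hs)
    refine h.congr_deriv ?_
    simp only [LinearMap.coe_toContinuousLinearMap', mulVecLin_apply, mulVec_mulVec, hPA]
  -- Here `k ≤ n` matters: without an index sequence the unit sphere would be empty.
  · have : Nonempty (IncSeq k n) := ⟨Fin.castLEOrderEmb hkn⟩
    have hunit : IsUnit (mulCompound k P) := by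
      refine IsUnit.of_mul_eq_one (mulCompound k P⁻¹) ?_
      rw [← mulCompound_mul, mul_nonsing_inv P hdet, mulCompound_one]
    exact exists_hasLogNorm_le hunit (hPA t) (hquad t ht)
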